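/- Let $\mathbb T^d=\mathbb R^d/\mathbb Z^d$ and let $\mathcal C(\mathbb T^d)$ carry the sup norm. Let $\mathcal C(\mathbb T^d)\cap\mathcal P$ be the set of continuous probability densities $m\ge 0$, $\int_{\mathbb T^d} m\,dx=1$. Let $H$ be a Hamiltonian depending locally on $m$: $H[m](x,p)=\tilde H(x,p,m(x))$ for $m\in \mathcal C(\mathbb T^d)$, $x\in\mathbb T^d$, $p\in\mathbb R^d$. For $p\in\mathcal C(\mathbb T^d;\mathbb R^d)$ put $$\mathcal H[m,p]=\int_{\mathbb T^d} m(x)\,H[m](x,p(x))\,dx ,$$ and let $D^2_{m,m}\mathcal H[m,p]$ be its second Fréchet derivative with respect to $m\in\mathcal C(\mathbb T^d)$. For a set $S$ of densities, the uniqueness condition on $S$ consists of: 1. for all $m\in S$ and $p\in \mathcal C(\mathbb T^d;\mathbb R^d)$, $\mathcal H[\cdot,p]$ is $C^2$ at $m$ and the quadratic form $\mu\mapsto D^2_{m,m}\mathcal H[m,p](\mu,\mu)$ on $\mathcal C(\mathbb T^d)$ is positive definite ($>0$ for every $\mu\neq0$); 2. for all $m\in S$ and $x\in\mathbb T^d$,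 $p\mapsto H[m](x,p)$ is strictly concave on $\mathbb R^d$. The condition of the uniqueness theorem for classical solutions of the mean field type control system is the uniqueness condition on $S=\mathcal C(\mathbb T^d)\cap\mathcal P$. Then: (a) Suppose $\tilde H$ is $C^2$ in $(x,p,m)$ near every point with $m\ge0$, and that for all $x$, $p$ and all $m\ge 0$ the function $\tilde H(x,\cdot,m)$ is strictly concave on $\mathbb R^d$ and $\frac{\partial^2}{\partial m^2}\bigl(m\tilde H(x,p,m)\bigr)>0$. Then the uniqueness condition holds on $\mathcal C(\mathbb T^d)\cap\mathcal P$. (b) Suppose the assumptions of (a) hold for all $m>0$ only (in place of $m\ge0$). Then the uniqueness condition holds on the set of those $m\in\mathcal C(\mathbb T^d)\cap\mathcal P$ that are positive everywhere. (c) Suppose $\tilde H$ is $C^2$ in $(x,p,m)$ near every point with $m\ge0$, $\tilde H(x,\cdot,m)$ is strictly concave for all $x$ and all $m>0$, and $m\mapsto m\tilde H(x,p,m)$ is strictly convex on $[0,\infty)$ for all $x,p$, strict convexity being only the strict chord inequality. Then for every $p\in \mathcal C(\mathbb T^d;\mathbb R^d)$ the functional $m\mapsto\mathcal H[m,p]$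 is strictly convex on $\mathcal C(\mathbb T^d)\cap\mathcal P$; for every $m\in\mathcal C(\mathbb T^d)\cap\mathcal P$ it is $C^2$ at $m$ with $D^2_{m,m}\mathcal H[m,p]$ positive semidefinite; and for all $m\in\mathcal C(\mathbb T^d)\cap\mathcal P$ and $x\in\mathbb T^d$ the function $p\mapsto H[m](x,p)$ is concave, and strictly concave if $m(x)>0$. -/

import Mathlib

open MeasureTheory Set

noncomputable section

namespace MFTC

/-- The unit torus `𝕋^d = ℝ^d / ℤ^d`; its `volume` is the Lebesgue measure, of total mass one. -/
abbrev Torus (d : ℕ) : Type := UnitAddTorus (Fin d)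

/-- The Euclidean space `ℝ^d`. -/
abbrev Vec (d : ℕ) : Type := EuclideanSpace ℝ (Fin d)

/-- The projection `ℝ^d → 𝕋^d`. -/
def Torus.proj {d : ℕ} (y : Vec d) : Torus d := fun i => ((y i : ℝ) : UnitAddCircle)

/-- A Hamiltonian `(m, x, q) ↦ H[m](x, q)`, where `m` is a continuous function on the torus. -/
abbrev Hamiltonian (d : ℕ) : Type := C(Torus d, ℝ) → Torus d → Vec d → ℝ

/-- `𝓒(𝕋^d) ∩ 𝒫`: the continuous probability densities on the torus. -/
def contDensities (d : ℕ) : Set C(Torus d, ℝ) :=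
  {m | (∀ x, 0 ≤ m x) ∧ ∫ x, m x = 1}

/-- The continuous probability densities that vanish nowhere. -/
def posDensities (d : ℕ) : Set C(Torus d, ℝ) :=
  {m | m ∈ contDensities d ∧ ∀ x, 0 < m x}

/-- The functional `𝓗[m, p] = ∫ m(x) H[m](x, p(x)) dx`. -/
def energy {d : ℕ} (H : Hamiltonian d) (m : C(Torus d, ℝ)) (p : C(Torus d, Vec d)) : ℝ :=
  ∫ x, m x * H m x (p x)

/-- The second order Fréchet derivative `D²_{m,m} 𝓗[m, p]` with respect to `m` in the Banach
space `𝓒(𝕋^d)` (with the sup norm), a bilinear form on `𝓒(𝕋^d)`. -/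
def energyD2 {d : ℕ} (H : Hamiltonian d) (m : C(Torus d, ℝ)) (p : C(Torus d, Vec d)) :
    C(Torus d, ℝ) →L[ℝ] C(Torus d, ℝ) →L[ℝ] ℝ :=
  fderiv ℝ (fun m₁ => fderiv ℝ (fun m₂ => energy H m₂ p) m₁) m

/-- The two requirements of the uniqueness theorem, for the densities `m ∈ S`:
`𝓗[·, p]` is twice continuously Fréchet differentiable at `m` and `μ ↦ D²_{m,m} 𝓗[m, p](μ, μ)`
is positive definite for every continuous `p`, and `q ↦ H[m](x, q)` is strictly concave for
every `x`. -/
def UniquenessConditionOn {d : ℕ} (S : Set C(Torus d, ℝ)) (H : Hamiltonian d) : Prop :=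
  (∀ m ∈ S, ∀ p : C(Torus d, Vec d),
    ContDiffAt ℝ 2 (fun m' => energy H m' p) m ∧
      ∀ μ : C(Torus d, ℝ), μ ≠ 0 → 0 < energyD2 H m p μ μ) ∧
  (∀ m ∈ S, ∀ x, StrictConcaveOn ℝ univ (H m x))

/-- The sufficient condition of the uniqueness theorem: the two requirements hold for all
`m ∈ 𝓒(𝕋^d) ∩ 𝒫`. -/
def UniquenessCondition {d : ℕ} (H : Hamiltonian d) : Prop :=
  UniquenessConditionOn (contDensities d) H

/-- `H` depends locally on `m`: `H[m](x, q) = H̃(x, q, m(x))`. -/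
def DependsLocally {d : ℕ} (H : Hamiltonian d) (Ht : Torus d → Vec d → ℝ → ℝ) : Prop :=
  ∀ m x q, H m x q = Ht x q (m x)

/-- `H̃` is of class `C²` in `(x, q, r)` in a neighbourhood of every point with `r ∈ I`
(differentiability in `x` being that of the periodic lift to `ℝ^d`). -/
def IsC2Along {d : ℕ} (I : Set ℝ) (Ht : Torus d → Vec d → ℝ → ℝ) : Prop :=
  ∀ (y q : Vec d), ∀ r ∈ I,
    ContDiffAt ℝ 2 (fun z : Vec d × Vec d × ℝ => Ht (Torus.proj z.1) z.2.1 z.2.2) (y, q, r)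

end MFTC

end

/-!
With `F(x, s) = s H̃(x, p(x), s)`, the energy is `𝓗[m, p] = ∫ F(x, m(x)) dx`: a continuous linear
form, integration, applied to the superposition operator `m ↦ F(·, m(·))` of `𝓒(𝕋^d)`.

A superposition operator is differentiable in the sup norm as soon as `F` and `∂ₛF` are jointly
continuous on an open set `U` containing the graph of `m`; no differentiability in `x` is needed,
which matters because `p`, hence `F`, is only continuous in `x`. By compactness the graph has a
vertical tube of constant width inside `U` on which `∂ₛF` oscillates little, and the mean value
inequality shows that the derivative at `m` is the multiplication by `∂ₛF(·, m(·))`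
(`FiberC1On.hasFDerivAt_superposition`). The derivative is again a superposition operator, so the
argument repeats: the energy is `C²` near `m`, and
`D²𝓗[m, p](μ, ν) = ∫ ∂ₛ²F(x, m(x)) μ(x) ν(x) dx` (`MFTC.energyD2_apply`).

The joint continuity of `F`, `∂ₛF` and `∂ₛ²F` comes from that of the partial derivatives of the
lift of `s H̃(x, q, s)` to `ℝ^d × ℝ^d × ℝ`, because the projection `ℝ^d → 𝕋^d` is an open quotient
map (`MFTC.fiberC1On_of_contDiffAt_lift`). Only values `s` near the range of `m` enter, so `C²`
regularity near the values of the density suffices.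

Positive definiteness then follows from `∂ₛ²F > 0`, as the Lebesgue measure charges every nonempty
open set. When `s ↦ s H̃` is only assumed strictly convex, the chord inequality is integrated
(`MFTC.strictConvexOn_energy`), `∂ₛ²F ≥ 0` holds on `[0, ∞)` because `∂ₛF` is monotone there, and
concavity in `q` where the density vanishes is a limit of concavity at positive values.
-/

open Filter Topology

noncomputable section

/-! ### Superposition operators on spaces of continuous functions -/

section Superposition

variable {X : Type*} [TopologicalSpace X]

/-- `F : X → ℝ → ℝ` is jointly continuous on `U ⊆ X × ℝ`, and so is its partial derivative in the
real variable. No regularity beyond continuity is asked for in the variable of `X`. -/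
structure FiberC1On (U : Set (X × ℝ)) (F : X → ℝ → ℝ) : Prop where
  continuousOn : ContinuousOn (fun z : X × ℝ => F z.1 z.2) U
  differentiableAt : ∀ z ∈ U, DifferentiableAt ℝ (F z.1) z.2
  continuousOn_deriv : ContinuousOn (fun z : X × ℝ => deriv (F z.1) z.2) U

/-- The continuous functions whose graph lies in `U`. -/
def graphsIn (U : Set (X × ℝ)) : Set C(X, ℝ) := {m | ∀ x, (x, m x) ∈ U}

open Classical in
/-- The superposition (Nemytskii) operator `m ↦ F(·, m(·))` on `C(X, ℝ)`, with value `0` at those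
`m` for which `F(·, m(·))` is not continuous. -/
def superposition (F : X → ℝ → ℝ) (m : C(X, ℝ)) : C(X, ℝ) :=
  if h : Continuous (fun x => F x (m x)) then ⟨fun x => F x (m x), h⟩ else 0

theorem continuous_comp_graph {U : Set (X × ℝ)} {F : X → ℝ → ℝ}
    (hF : ContinuousOn (fun z : X × ℝ => F z.1 z.2) U) {m : C(X, ℝ)} (hm : m ∈ graphsIn U) :
    Continuous (fun x => F x (m x)) :=
  hF.comp_continuous (continuous_id.prodMk m.continuous) hm

theorem superposition_apply {U : Set (X × ℝ)} {F : X → ℝ → ℝ}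
    (hF : ContinuousOn (fun z : X × ℝ => F z.1 z.2) U) {m : C(X, ℝ)} (hm : m ∈ graphsIn U)
    (x : X) : superposition F m x = F x (m x) := by
  simp [superposition, continuous_comp_graph hF hm]

variable [CompactSpace X]

/-- A property that holds near the graph of a continuous function on a compact space holds on a
vertical tube of constant width about that graph. -/
theorem exists_tube_of_eventually_nhds_graph {P : X → ℝ → Prop} (m : C(X, ℝ))
    (h : ∀ x, ∀ᶠ z in 𝓝 (x, m x), P z.1 z.2) :
    ∃ δ > 0, ∀ x s, |s - m x| < δ → P x s := by
  have key : ∀ᶠ t in 𝓝 (0 : ℝ), ∀ x ∈ (univ : Set X), P x (m x + t) := by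
    refine isCompact_univ.eventually_forall_of_forall_eventually fun x _ => ?_
    have hc : Tendsto (fun z : ℝ × X => (z.2, m z.2 + z.1)) (𝓝 (0, x)) (𝓝 (x, m x)) := by
      have : Continuous (fun z : ℝ × X => (z.2, m z.2 + z.1)) := by fun_prop
      simpa using this.tendsto (0, x)
    exact hc.eventually (h x)
  obtain ⟨δ, hδ, hP⟩ := Metric.eventually_nhds_iff.1 key
  refine ⟨δ, hδ, fun x s hs => ?_⟩
  simpa using hP (y := s - m x) (by simpa [Real.dist_eq] using hs) x (mem_univ x)

theorem isOpen_graphsIn {U : Set (X × ℝ)} (hU : IsOpen U) : IsOpen (graphsIn U) := by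
  refine Metric.isOpen_iff.2 fun m hm => ?_
  obtain ⟨δ, hδ, h⟩ := exists_tube_of_eventually_nhds_graph (P := fun x s => (x, s) ∈ U) m
    fun x => hU.mem_nhds (hm x)
  exact ⟨δ, hδ, fun m' hm' x => h x _ <| by
    simpa [Real.dist_eq] using (ContinuousMap.dist_apply_le_dist x).trans_lt hm'⟩

theorem continuousAt_superposition {U : Set (X × ℝ)} (hU : IsOpen U) {F : X → ℝ → ℝ}
    (hF : ContinuousOn (fun z : X × ℝ => F z.1 z.2) U) {m : C(X, ℝ)} (hm : m ∈ graphsIn U) :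
    ContinuousAt (superposition F) m := by
  refine Metric.continuousAt_iff.2 fun ε hε => ?_
  obtain ⟨δ, hδ, h⟩ := exists_tube_of_eventually_nhds_graph
    (P := fun x s => (x, s) ∈ U ∧ |F x s - F x (m x)| < ε / 2) m fun x => by
      have h1 := hF.continuousAt (hU.mem_nhds (hm x))
      have h2 : ContinuousAt (fun z : X × ℝ => F z.1 (m z.1)) (x, m x) :=
        ((continuous_comp_graph hF hm).comp continuous_fst).continuousAt
      have h3 := (h1.sub h2).abs
      refine Eventually.and (hU.mem_nhds (hm x)) (h3.eventually_lt_const ?_)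
      simpa using half_pos hε
  refine ⟨δ, hδ, fun {m'} hm' => ?_⟩
  have hx : ∀ x, |m' x - m x| < δ := fun x => by
    simpa [Real.dist_eq] using (ContinuousMap.dist_apply_le_dist x).trans_lt hm'
  have hmU : m' ∈ graphsIn U := fun x => (h x _ (hx x)).1
  refine lt_of_le_of_lt ((ContinuousMap.dist_le (half_pos hε).le).2 fun x => ?_) (half_lt_self hε)
  rw [superposition_apply hF hmU, superposition_apply hF hm, Real.dist_eq]
  exact (h x _ (hx x)).2.le

/-- The superposition operator of a fiberwise `C¹` function is Fréchet differentiable, and its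
derivative at `m` is the multiplication by `∂ₛF(·, m(·))`: the mean value inequality bounds the
remainder, uniformly in `x` by compactness. -/
theorem FiberC1On.hasFDerivAt_superposition {U : Set (X × ℝ)} (hU : IsOpen U) {F : X → ℝ → ℝ}
    (hF : FiberC1On U F) {m : C(X, ℝ)} (hm : m ∈ graphsIn U) :
    HasFDerivAt (superposition F)
      (ContinuousLinearMap.mul ℝ C(X, ℝ) (superposition (fun x => deriv (F x)) m)) m := by
  refine HasFDerivAt.of_isLittleO (Asymptotics.isLittleO_iff.2 fun c hc => ?_)
  obtain ⟨δ, hδ, h⟩ := exists_tube_of_eventually_nhds_graph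
    (P := fun x s => (x, s) ∈ U ∧ |deriv (F x) s - deriv (F x) (m x)| < c) m fun x => by
      have h1 := hF.continuousOn_deriv.continuousAt (hU.mem_nhds (hm x))
      have h2 : ContinuousAt (fun z : X × ℝ => deriv (F z.1) (m z.1)) (x, m x) :=
        ((continuous_comp_graph (F := fun x => deriv (F x)) hF.continuousOn_deriv hm).comp
          continuous_fst).continuousAt
      have h3 := (h1.sub h2).abs
      refine Eventually.and (hU.mem_nhds (hm x)) (h3.eventually_lt_const ?_)
      simpa using hc
  filter_upwards [Metric.ball_mem_nhds m hδ] with m' hm'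
  have hx : ∀ x, |m' x - m x| < δ := fun x => by
    simpa [Real.dist_eq] using (ContinuousMap.dist_apply_le_dist x).trans_lt hm'
  have hmU : m' ∈ graphsIn U := fun x => (h x _ (hx x)).1
  refine (ContinuousMap.norm_le _ (by positivity)).2 fun x => ?_
  have hd : ∀ s ∈ Metric.ball (m x) δ, HasDerivWithinAt
      (fun s => F x s - deriv (F x) (m x) * s) (deriv (F x) s - deriv (F x) (m x))
      (Metric.ball (m x) δ) s := fun s hs => by
    have h1 := (hF.differentiableAt (x, s) (h x s (by simpa [Real.dist_eq] using hs)).1).hasDerivAt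
    have h2 : HasDerivAt (fun s => deriv (F x) (m x) * s) (deriv (F x) (m x)) s := by
      simpa using (hasDerivAt_id s).const_mul (deriv (F x) (m x))
    exact (h1.sub h2).hasDerivWithinAt
  have hmv := (convex_ball (m x) δ).norm_image_sub_le_of_norm_hasDerivWithin_le hd
    (fun s hs => (h x s (by simpa [Real.dist_eq] using hs)).2.le)
    (Metric.mem_ball_self hδ) (y := m' x) (by simpa [Real.dist_eq] using hx x)
  have hn : ‖m' x - m x‖ ≤ ‖m' - m‖ := (m' - m).norm_coe_le_norm x
  have hval : (superposition F m' - superposition F m -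
      (ContinuousLinearMap.mul ℝ C(X, ℝ) (superposition (fun x => deriv (F x)) m)) (m' - m)) x =
      F x (m' x) - deriv (F x) (m x) * m' x - (F x (m x) - deriv (F x) (m x) * m x) := by
    simp only [ContinuousMap.sub_apply, ContinuousLinearMap.mul_apply', ContinuousMap.mul_apply,
      superposition_apply hF.continuousOn hmU, superposition_apply hF.continuousOn hm,
      superposition_apply (F := fun x => deriv (F x)) hF.continuousOn_deriv hm]
    ring
  rw [hval]
  exact hmv.trans (mul_le_mul_of_nonneg_left hn hc.le)

theorem FiberC1On.contDiffAt_superposition {U : Set (X × ℝ)} (hU : IsOpen U) {F : X → ℝ → ℝ}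
    (hF : FiberC1On U F) {m : C(X, ℝ)} (hm : m ∈ graphsIn U) :
    ContDiffAt ℝ 1 (superposition F) m := by
  have hΩ := isOpen_graphsIn hU
  refine (contDiffAt_succ_iff_hasFDerivAt (n := 0)).2
    ⟨_, ⟨graphsIn U, hΩ.mem_nhds hm, fun m' hm' => hF.hasFDerivAt_superposition hU hm'⟩, ?_⟩
  refine ContDiffAt.continuousLinearMap_comp _ (contDiffAt_zero.2 ⟨graphsIn U, hΩ.mem_nhds hm, ?_⟩)
  exact fun m' hm' =>
    (continuousAt_superposition hU hF.continuousOn_deriv hm').continuousWithinAt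

theorem contDiffAt_two_superposition {U : Set (X × ℝ)} (hU : IsOpen U) {F : X → ℝ → ℝ}
    (hF : FiberC1On U F) (hF' : FiberC1On U (fun x => deriv (F x))) {m : C(X, ℝ)}
    (hm : m ∈ graphsIn U) : ContDiffAt ℝ 2 (superposition F) m := by
  refine (contDiffAt_succ_iff_hasFDerivAt (n := 1)).2
    ⟨_, ⟨graphsIn U, (isOpen_graphsIn hU).mem_nhds hm,
      fun m' hm' => hF.hasFDerivAt_superposition hU hm'⟩, ?_⟩
  exact ContDiffAt.continuousLinearMap_comp _ (hF'.contDiffAt_superposition hU hm)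

/-- The second derivative of `m ↦ J(F(·, m(·)))`, for a continuous linear form `J`. -/
theorem fderiv_fderiv_comp_superposition {U : Set (X × ℝ)} (hU : IsOpen U) {F : X → ℝ → ℝ}
    (hF : FiberC1On U F) (hF' : FiberC1On U (fun x => deriv (F x))) {m : C(X, ℝ)}
    (hm : m ∈ graphsIn U) (J : C(X, ℝ) →L[ℝ] ℝ) (μ ν : C(X, ℝ)) :
    fderiv ℝ (fun m₁ => fderiv ℝ (fun m₂ => J (superposition F m₂)) m₁) m μ ν =
      J (superposition (fun x => deriv (deriv (F x))) m * μ * ν) := by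
  let A : C(X, ℝ) →L[ℝ] C(X, ℝ) →L[ℝ] ℝ :=
    (ContinuousLinearMap.compL ℝ C(X, ℝ) C(X, ℝ) ℝ J).comp (ContinuousLinearMap.mul ℝ C(X, ℝ))
  have h1 : (fun m₁ => fderiv ℝ (fun m₂ => J (superposition F m₂)) m₁) =ᶠ[𝓝 m]
      fun m₁ => A (superposition (fun x => deriv (F x)) m₁) := by
    filter_upwards [(isOpen_graphsIn hU).mem_nhds hm] with m₁ hm₁
    exact (J.hasFDerivAt.comp m₁ (hF.hasFDerivAt_superposition hU hm₁)).fderiv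
  have h2 : HasFDerivAt (fun m₁ => A (superposition (fun x => deriv (F x)) m₁)) _ m :=
    HasFDerivAt.comp (g := A) m A.hasFDerivAt (hF'.hasFDerivAt_superposition hU hm)
  rw [h1.fderiv_eq, h2.fderiv]
  simp [A]

end Superposition

/-! ### Integration of continuous functions on a compact space -/

section Integral

variable {X : Type*} [TopologicalSpace X] [CompactSpace X] [MeasurableSpace X] [BorelSpace X]
  (vol : Measure X) [IsFiniteMeasure vol]

theorem ContinuousMap.integrable_of_compactSpace (f : C(X, ℝ)) : Integrable f vol :=
  f.continuous.integrable_of_hasCompactSupport (HasCompactSupport.of_compactSpace f)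

/-- Integration as a continuous linear form on `C(X, ℝ)`. -/
def integralForm : C(X, ℝ) →L[ℝ] ℝ :=
  LinearMap.mkContinuous
    { toFun := fun f => ∫ x, f x ∂vol
      map_add' := fun f g => by
        simpa using integral_add (f.integrable_of_compactSpace vol)
          (g.integrable_of_compactSpace vol)
      map_smul' := fun c f => by simpa using integral_const_mul c (fun x => f x) }
    (vol.real univ) fun f => by
      simpa [mul_comm] using norm_integral_le_of_norm_le_const (μ := vol)
        (Eventually.of_forall fun x => f.norm_coe_le_norm x)

theorem integralForm_apply (f : C(X, ℝ)) : integralForm vol f = ∫ x, f x ∂vol := rfl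

theorem integralForm_nonneg {f : C(X, ℝ)} (hf : ∀ x, 0 ≤ f x) : 0 ≤ integralForm vol f :=
  integral_nonneg hf

theorem integralForm_pos [vol.IsOpenPosMeasure] {f : C(X, ℝ)} (hf : ∀ x, 0 ≤ f x) {x : X}
    (hx : 0 < f x) : 0 < integralForm vol f :=
  integral_pos_of_integrable_nonneg_nonzero f.continuous (f.integrable_of_compactSpace vol) hf
    hx.ne'

end Integral

/-! ### Partial derivatives in the last variable -/

section Partial

variable {E : Type*} [NormedAddCommGroup E] [NormedSpace ℝ E]

theorem DifferentiableAt.hasDerivAt_snd {K : E × ℝ → ℝ} {z : E × ℝ} (h : DifferentiableAt ℝ K z) :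
    HasDerivAt (fun s => K (z.1, s)) (fderiv ℝ K z (0, 1)) z.2 :=
  h.hasFDerivAt.comp_hasDerivAt z.2 ((hasDerivAt_const z.2 z.1).prodMk (hasDerivAt_id z.2))

theorem ContDiffAt.deriv_snd {K : E × ℝ → ℝ} {z : E × ℝ} {n : ℕ}
    (h : ContDiffAt ℝ (n + 1) K z) :
    ContDiffAt ℝ n (fun z : E × ℝ => deriv (fun s => K (z.1, s)) z.2) z := by
  have h1 : ContDiffAt ℝ n (fun z : E × ℝ => fderiv ℝ K z (0, 1)) z :=
    h.fderiv_right_succ.clm_apply contDiffAt_const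
  refine h1.congr_of_eventuallyEq ?_
  filter_upwards [h.eventually (by exact_mod_cast WithTop.coe_ne_top)] with w hw
  exact (hw.differentiableAt (by simp)).hasDerivAt_snd.deriv

end Partial

namespace MFTC

variable {d : ℕ}

/-! ### Functions on the torus and their periodic lifts -/

theorem Torus.isOpenQuotientMap_proj : IsOpenQuotientMap (Torus.proj (d := d)) :=
  (IsOpenQuotientMap.piMap fun _ : Fin d => QuotientAddGroup.isOpenQuotientMap_mk).comp
    (EuclideanSpace.equiv (Fin d) ℝ).toHomeomorph.isOpenQuotientMap

theorem Torus.isOpenQuotientMap_proj_prod :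
    IsOpenQuotientMap (fun w : Vec d × ℝ => (Torus.proj w.1, w.2)) :=
  Torus.isOpenQuotientMap_proj.prodMap IsOpenQuotientMap.id

/-- The lift of `G : 𝕋^d × ℝ^d × ℝ → ℝ`, periodic in its first variable. -/
def lift (G : Torus d → Vec d → ℝ → ℝ) (w : (Vec d × Vec d) × ℝ) : ℝ :=
  G (Torus.proj w.1.1) w.1.2 w.2

theorem continuousAt_of_continuousAt_lift {G : Torus d → Vec d → ℝ → ℝ} (p : C(Torus d, Vec d))
    {y : Vec d} {s : ℝ} (h : ContinuousAt (lift G) ((y, p (Torus.proj y)), s)) :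
    ContinuousAt (fun z : Torus d × ℝ => G z.1 (p z.1) z.2) (Torus.proj y, s) := by
  have hq := Torus.isOpenQuotientMap_proj_prod (d := d)
  have hm := hq.map_nhds_eq (y, s)
  have hc : Continuous fun w : Vec d × ℝ => ((w.1, p (Torus.proj w.1)), w.2) :=
    (continuous_fst.prodMk (p.continuous.comp
      (Torus.isOpenQuotientMap_proj.continuous.comp continuous_fst))).prodMk continuous_snd
  unfold ContinuousAt
  rw [← hm, tendsto_map'_iff]
  exact h.comp (f := fun w : Vec d × ℝ => ((w.1, p (Torus.proj w.1)), w.2)) (x := (y, s))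
    hc.continuousAt

/-- Although `x ↦ G(x, p(x), s)` is merely continuous, the joint smoothness of `G` makes it
fiberwise `C¹`: the partial derivative in `s` does not see the composition with `p`. -/
theorem fiberC1On_of_contDiffAt_lift {G : Torus d → Vec d → ℝ → ℝ} (p : C(Torus d, Vec d))
    {U : Set (Torus d × ℝ)}
    (h : ∀ z ∈ U, ∃ y, Torus.proj y = z.1 ∧ ContDiffAt ℝ 1 (lift G) ((y, p z.1), z.2)) :
    FiberC1On U (fun x s => G x (p x) s) where
  continuousOn := by
    rintro ⟨x, s⟩ hz
    obtain ⟨y, rfl, hy⟩ := h _ hz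
    exact (continuousAt_of_continuousAt_lift p hy.continuousAt).continuousWithinAt
  differentiableAt := by
    rintro ⟨x, s⟩ hz
    obtain ⟨y, rfl, hy⟩ := h _ hz
    exact (hy.differentiableAt (by simp)).hasDerivAt_snd.differentiableAt
  continuousOn_deriv := by
    rintro ⟨x, s⟩ hz
    obtain ⟨y, rfl, hy⟩ := h _ hz
    have h1 : ContDiffAt ℝ (0 : ℕ) (lift fun x q s => deriv (G x q) s)
        ((y, p (Torus.proj y)), s) := ContDiffAt.deriv_snd (n := 0) (by norm_num; exact hy)
    exact (continuousAt_of_continuousAt_lift p h1.continuousAt).continuousWithinAt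

/-- The integrand `s H̃(x, q, s)` of `𝓗`, as a function of the value `s` of the density. -/
def integrand (Ht : Torus d → Vec d → ℝ → ℝ) (x : Torus d) (q : Vec d) (s : ℝ) : ℝ :=
  s * Ht x q s

/-- The points `(x, s)` such that the integrand is `C²` near a lift of `(x, p(x), s)`. -/
def smoothSet (Ht : Torus d → Vec d → ℝ → ℝ) (p : C(Torus d, Vec d)) : Set (Torus d × ℝ) :=
  {z | ∃ y, Torus.proj y = z.1 ∧ ContDiffAt ℝ 2 (lift (integrand Ht)) ((y, p z.1), z.2)}

variable {Ht : Torus d → Vec d → ℝ → ℝ} {p : C(Torus d, Vec d)}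

theorem isOpen_smoothSet : IsOpen (smoothSet Ht p) := by
  have hc : Continuous fun w : Vec d × ℝ => ((w.1, p (Torus.proj w.1)), w.2) :=
    (continuous_fst.prodMk (p.continuous.comp
      (Torus.isOpenQuotientMap_proj.continuous.comp continuous_fst))).prodMk continuous_snd
  have ho : IsOpen {w | ContDiffAt ℝ 2 (lift (integrand Ht)) w} :=
    isOpen_iff_mem_nhds.2 fun w hw => ContDiffAt.eventually hw (by simp)
  convert Torus.isOpenQuotientMap_proj_prod.isOpenMap _ (ho.preimage hc) using 1
  ext ⟨x, s⟩
  constructor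
  · rintro ⟨y, rfl, hy⟩
    exact ⟨(y, s), hy, rfl⟩
  · rintro ⟨⟨y, s⟩, hy, h⟩
    obtain ⟨rfl, rfl⟩ := Prod.mk.inj h
    exact ⟨y, rfl, hy⟩

theorem mem_smoothSet {I : Set ℝ} (h : IsC2Along I Ht) (x : Torus d) {r : ℝ} (hr : r ∈ I) :
    (x, r) ∈ smoothSet Ht p := by
  obtain ⟨y, rfl⟩ := Torus.isOpenQuotientMap_proj.surjective x
  refine ⟨y, rfl, contDiffAt_snd.mul ?_⟩
  have hg : ContDiffAt ℝ 2 (fun w : (Vec d × Vec d) × ℝ => (w.1.1, w.1.2, w.2))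
      ((y, p (Torus.proj y)), r) := by fun_prop
  exact ContDiffAt.comp ((y, p (Torus.proj y)), r) (h y (p (Torus.proj y)) r hr) hg

theorem mem_graphsIn_smoothSet {I : Set ℝ} (h : IsC2Along I Ht) {m : C(Torus d, ℝ)}
    (hm : ∀ x, m x ∈ I) : m ∈ graphsIn (smoothSet Ht p) :=
  fun x => mem_smoothSet h x (hm x)

theorem fiberC1On_integrand :
    FiberC1On (smoothSet Ht p) (fun x s => integrand Ht x (p x) s) :=
  fiberC1On_of_contDiffAt_lift p fun _ ⟨y, hy, h⟩ => ⟨y, hy, h.of_le one_le_two⟩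

theorem fiberC1On_deriv_integrand :
    FiberC1On (smoothSet Ht p) (fun x => deriv (integrand Ht x (p x))) :=
  fiberC1On_of_contDiffAt_lift (G := fun x q => deriv (integrand Ht x q)) p
    fun _ ⟨y, hy, h⟩ => ⟨y, hy, ContDiffAt.deriv_snd (n := 1) h⟩

theorem superposition_integrand_apply {m : C(Torus d, ℝ)}
    (hm : m ∈ graphsIn (smoothSet Ht p)) (x : Torus d) :
    superposition (fun x s => integrand Ht x (p x) s) m x = m x * Ht x (p x) (m x) :=
  superposition_apply (F := fun x s => integrand Ht x (p x) s)
    fiberC1On_integrand.continuousOn hm x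

/-! ### The energy functional -/

variable {H : Hamiltonian d}

theorem energy_eq_integralForm (hloc : DependsLocally H Ht) {m : C(Torus d, ℝ)}
    (hm : m ∈ graphsIn (smoothSet Ht p)) :
    energy H m p =
      integralForm volume (superposition (fun x s => integrand Ht x (p x) s) m) := by
  rw [integralForm_apply]
  refine integral_congr_ae (Eventually.of_forall fun x => ?_)
  simp only [superposition_integrand_apply hm, hloc m]

theorem energy_eventuallyEq (hloc : DependsLocally H Ht) {m : C(Torus d, ℝ)}
    (hm : m ∈ graphsIn (smoothSet Ht p)) :
    (fun m' => energy H m' p) =ᶠ[𝓝 m] fun m' =>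
      integralForm volume (superposition (fun x s => integrand Ht x (p x) s) m') := by
  filter_upwards [(isOpen_graphsIn isOpen_smoothSet).mem_nhds hm] with m' hm'
  exact energy_eq_integralForm hloc hm'

theorem contDiffAt_energy (hloc : DependsLocally H Ht) {m : C(Torus d, ℝ)}
    (hm : m ∈ graphsIn (smoothSet Ht p)) : ContDiffAt ℝ 2 (fun m' => energy H m' p) m := by
  have h := contDiffAt_two_superposition isOpen_smoothSet fiberC1On_integrand
    fiberC1On_deriv_integrand hm
  have hJ := ContDiffAt.continuousLinearMap_comp (integralForm volume) h
  exact hJ.congr_of_eventuallyEq (energy_eventuallyEq hloc hm)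

/-- The second derivative of the energy is the integral of `∂ₛ²(s H̃(x, p(x), s)) μ(x) ν(x)` at
`s = m(x)`. -/
theorem energyD2_apply (hloc : DependsLocally H Ht) {m : C(Torus d, ℝ)}
    (hm : m ∈ graphsIn (smoothSet Ht p)) (μ ν : C(Torus d, ℝ)) :
    energyD2 H m p μ ν = integralForm volume
      (superposition (fun x => deriv (deriv (integrand Ht x (p x)))) m * μ * ν) := by
  rw [energyD2, (energy_eventuallyEq hloc hm).fderiv.fderiv_eq]
  exact fderiv_fderiv_comp_superposition isOpen_smoothSet fiberC1On_integrand
    fiberC1On_deriv_integrand hm _ μ ν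

theorem superposition_deriv_deriv_apply {m : C(Torus d, ℝ)}
    (hm : m ∈ graphsIn (smoothSet Ht p)) (x : Torus d) :
    superposition (fun x => deriv (deriv (integrand Ht x (p x)))) m x =
      deriv (deriv (integrand Ht x (p x))) (m x) :=
  superposition_apply (F := fun x => deriv (deriv (integrand Ht x (p x))))
    fiberC1On_deriv_integrand.continuousOn_deriv hm x

theorem energyD2_nonneg (hloc : DependsLocally H Ht) {m : C(Torus d, ℝ)}
    (hm : m ∈ graphsIn (smoothSet Ht p))
    (h : ∀ x, 0 ≤ deriv (deriv (integrand Ht x (p x))) (m x)) (μ : C(Torus d, ℝ)) :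
    0 ≤ energyD2 H m p μ μ := by
  rw [energyD2_apply hloc hm]
  refine integralForm_nonneg _ fun x => ?_
  simp only [ContinuousMap.mul_apply, superposition_deriv_deriv_apply hm, mul_assoc]
  exact mul_nonneg (h x) (mul_self_nonneg _)

theorem energyD2_pos (hloc : DependsLocally H Ht) {m : C(Torus d, ℝ)}
    (hm : m ∈ graphsIn (smoothSet Ht p))
    (h : ∀ x, 0 < deriv (deriv (integrand Ht x (p x))) (m x)) {μ : C(Torus d, ℝ)} (hμ : μ ≠ 0) :
    0 < energyD2 H m p μ μ := by
  obtain ⟨x, hx⟩ := DFunLike.ne_iff.1 hμ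
  rw [energyD2_apply hloc hm]
  refine integralForm_pos _ (x := x) (fun x => ?_) ?_
  · simp only [ContinuousMap.mul_apply, superposition_deriv_deriv_apply hm, mul_assoc]
    exact mul_nonneg (h x).le (mul_self_nonneg _)
  · simp only [ContinuousMap.mul_apply, superposition_deriv_deriv_apply hm, mul_assoc]
    exact mul_pos (h x) (mul_self_pos.2 hx)

/-- The uniqueness condition for the continuous densities with values in `I`, from the pointwise
conditions for the values in `I`. -/
theorem uniquenessConditionOn_of_pointwise (hloc : DependsLocally H Ht) {I : Set ℝ}
    {S : Set C(Torus d, ℝ)} (hS : ∀ m ∈ S, ∀ x, m x ∈ I) (hC2 : IsC2Along I Ht)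
    (hconc : ∀ x, ∀ r ∈ I, StrictConcaveOn ℝ univ (fun q => Ht x q r))
    (hpos : ∀ x q, ∀ r ∈ I, 0 < iteratedDeriv 2 (fun s => s * Ht x q s) r) :
    UniquenessConditionOn S H := by
  refine ⟨fun m hm p => ?_, fun m hm x => ?_⟩
  · have hg : m ∈ graphsIn (smoothSet Ht p) := mem_graphsIn_smoothSet hC2 (hS m hm)
    refine ⟨contDiffAt_energy hloc hg, fun μ hμ => energyD2_pos hloc hg (fun x => ?_) hμ⟩
    have h := hpos x (p x) (m x) (hS m hm x)
    rwa [iteratedDeriv_succ, iteratedDeriv_one] at h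
  · have h : H m x = fun q => Ht x q (m x) := funext (hloc m x)
    rw [h]
    exact hconc x _ (hS m hm x)

/-! ### Strict convexity of the energy from the chord inequality -/

theorem convex_contDensities : Convex ℝ (contDensities d) := by
  intro m₁ h₁ m₂ h₂ a b ha hb hab
  refine ⟨fun x => ?_, ?_⟩
  · simpa using add_nonneg (mul_nonneg ha (h₁.1 x)) (mul_nonneg hb (h₂.1 x))
  · have h := map_add (integralForm (volume : Measure (Torus d))) (a • m₁) (b • m₂)
    simp only [map_smul, integralForm_apply, h₁.2, h₂.2, smul_eq_mul, mul_one, hab] at h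
    exact h

theorem strictConvexOn_energy (hloc : DependsLocally H Ht) (hC2 : IsC2Along (Ici 0) Ht)
    (hconv : ∀ x q, StrictConvexOn ℝ (Ici 0) (fun s => s * Ht x q s)) (p : C(Torus d, Vec d)) :
    StrictConvexOn ℝ (contDensities d) (fun m => energy H m p) := by
  refine ⟨convex_contDensities, fun m₁ h₁ m₂ h₂ hne a b ha hb hab => ?_⟩
  have hg : ∀ m ∈ contDensities d, m ∈ graphsIn (smoothSet Ht p) :=
    fun m hm => mem_graphsIn_smoothSet hC2 hm.1
  have h₃ := convex_contDensities h₁ h₂ ha.le hb.le hab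
  obtain ⟨x₀, hx₀⟩ := DFunLike.ne_iff.1 hne
  have hS := fun m hm => superposition_integrand_apply (hg m hm)
  simp only [energy_eq_integralForm hloc (hg _ h₁), energy_eq_integralForm hloc (hg _ h₂),
    energy_eq_integralForm hloc (hg _ h₃)]
  rw [← sub_pos, ← map_smul, ← map_smul, ← map_add, ← map_sub]
  refine integralForm_pos _ (x := x₀) (fun x => ?_) ?_
  · simp only [ContinuousMap.sub_apply, ContinuousMap.add_apply, ContinuousMap.smul_apply,
      hS _ h₁, hS _ h₂, hS _ h₃, sub_nonneg]
    exact (hconv x (p x)).convexOn.2 (h₁.1 x) (h₂.1 x) ha.le hb.le hab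
  · simp only [ContinuousMap.sub_apply, ContinuousMap.add_apply, ContinuousMap.smul_apply,
      hS _ h₁, hS _ h₂, hS _ h₃, sub_pos]
    exact (hconv x₀ (p x₀)).2 (h₁.1 x₀) (h₂.1 x₀) hx₀ ha hb hab

/-- The chord inequality on `[0, ∞)` bounds the second derivative from below up to the endpoint
`0`, since the integrand is differentiable across it. -/
theorem deriv_deriv_integrand_nonneg (hC2 : IsC2Along (Ici 0) Ht) {x : Torus d}
    (hconv : ConvexOn ℝ (Ici 0) (fun s => s * Ht x (p x) s)) {r : ℝ} (hr : 0 ≤ r) :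
    0 ≤ deriv (deriv (integrand Ht x (p x))) r := by
  have hmem : ∀ r ∈ Ici (0 : ℝ), (x, r) ∈ smoothSet Ht p := fun r hr => mem_smoothSet hC2 x hr
  have hmono : MonotoneOn (deriv (integrand Ht x (p x))) (Ici 0) :=
    hconv.monotoneOn_deriv fun r hr => fiberC1On_integrand.differentiableAt _ (hmem r hr)
  have hd := fiberC1On_deriv_integrand.differentiableAt _ (hmem r hr)
  have h := hmono.derivWithin_nonneg (x := r)
  rwa [hd.derivWithin (uniqueDiffOn_Ici 0 r hr)] at h

/-- The endpoint `r = 0` inherits concavity, though not strict concavity, from `r > 0` by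
continuity. -/
theorem concaveOn_of_strictConcaveOn_pos (hC2 : IsC2Along (Ici 0) Ht) {x : Torus d}
    (hconc : ∀ r : ℝ, 0 < r → StrictConcaveOn ℝ univ (fun q => Ht x q r)) {r : ℝ} (hr : 0 ≤ r) :
    ConcaveOn ℝ univ (fun q => Ht x q r) := by
  obtain hr | rfl := hr.lt_or_eq
  · exact (hconc r hr).concaveOn
  obtain ⟨y, rfl⟩ := Torus.isOpenQuotientMap_proj.surjective x
  have hlim : ∀ q, Tendsto (fun s => Ht (Torus.proj y) q s) (𝓝[>] 0)
      (𝓝 (Ht (Torus.proj y) q 0)) := fun q => by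
    have hc : ContinuousAt (fun s : ℝ => (y, q, s)) 0 := by fun_prop
    exact (ContinuousAt.comp (x := (0 : ℝ)) (f := fun s : ℝ => (y, q, s))
      (hC2 y q 0 self_mem_Ici).continuousAt hc).tendsto.mono_left nhdsWithin_le_nhds
  refine ⟨convex_univ, fun q₁ h₁ q₂ h₂ a b ha hb hab => ?_⟩
  refine le_of_tendsto_of_tendsto (((hlim q₁).const_smul a).add ((hlim q₂).const_smul b))
    (hlim _) ?_
  filter_upwards [self_mem_nhdsWithin] with s hs
  exact (hconc s hs).concaveOn.2 h₁ h₂ ha hb hab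

end MFTC

end

theorem mainTheorem4 (d : ℕ) (H : MFTC.Hamiltonian d)
    (Ht : MFTC.Torus d → MFTC.Vec d → ℝ → ℝ) (hloc : MFTC.DependsLocally H Ht) :
    -- conditions on `H̃` for all `r ≥ 0`: the uniqueness condition, for all densities
    (MFTC.IsC2Along (Set.Ici 0) Ht →
      (∀ x, ∀ r : ℝ, 0 ≤ r → StrictConcaveOn ℝ Set.univ (fun q => Ht x q r)) →
      (∀ x q, ∀ r : ℝ, 0 ≤ r → 0 < iteratedDeriv 2 (fun s => s * Ht x q s) r) →
      MFTC.UniquenessCondition H) ∧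
    -- conditions on `H̃` for all `r > 0` only: the same, for the positive densities
    (MFTC.IsC2Along (Set.Ioi 0) Ht →
      (∀ x, ∀ r : ℝ, 0 < r → StrictConcaveOn ℝ Set.univ (fun q => Ht x q r)) →
      (∀ x q, ∀ r : ℝ, 0 < r → 0 < iteratedDeriv 2 (fun s => s * Ht x q s) r) →
      MFTC.UniquenessConditionOn (MFTC.posDensities d) H) ∧
    -- strict convexity in the sense of chords: `𝓗[·, p]` is strictly convex on the densities
    (MFTC.IsC2Along (Set.Ici 0) Ht →
      (∀ x, ∀ r : ℝ, 0 < r → StrictConcaveOn ℝ Set.univ (fun q => Ht x q r)) →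
      (∀ x q, StrictConvexOn ℝ (Set.Ici 0) (fun s => s * Ht x q s)) →
      (∀ p, StrictConvexOn ℝ (MFTC.contDensities d) (fun m => MFTC.energy H m p)) ∧
      (∀ m ∈ MFTC.contDensities d, ∀ p,
        ContDiffAt ℝ 2 (fun m' => MFTC.energy H m' p) m ∧
          ∀ μ, 0 ≤ MFTC.energyD2 H m p μ μ) ∧
      (∀ m ∈ MFTC.contDensities d, ∀ x,
        ConcaveOn ℝ Set.univ (H m x) ∧
          (0 < m x → StrictConcaveOn ℝ Set.univ (H m x)))) := by
  refine ⟨fun hC2 hconc hpos => ?_, fun hC2 hconc hpos => ?_, fun hC2 hconc hconv => ⟨?_, ?_, ?_⟩⟩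
  · exact MFTC.uniquenessConditionOn_of_pointwise hloc (fun m hm => hm.1) hC2 hconc hpos
  · exact MFTC.uniquenessConditionOn_of_pointwise hloc (fun m hm => hm.2) hC2 hconc hpos
  · exact MFTC.strictConvexOn_energy hloc hC2 hconv
  · intro m hm p
    have hg := MFTC.mem_graphsIn_smoothSet (p := p) hC2 hm.1
    exact ⟨MFTC.contDiffAt_energy hloc hg, MFTC.energyD2_nonneg hloc hg fun x =>
      MFTC.deriv_deriv_integrand_nonneg hC2 (hconv x (p x)).convexOn (hm.1 x)⟩
  · intro m hm x
    rw [show H m x = fun q => Ht x q (m x) from funext (hloc m x)]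
    exact ⟨MFTC.concaveOn_of_strictConcaveOn_pos hC2 (hconc x) (hm.1 x), hconc x (m x)⟩
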